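/- A tournament matrix of order $n$ is an $n\times n$ $(0,1)$-matrix $A=(a_{ij})$ with $A+A^T=J-I$, where $J$ is the all-ones matrix; an upset of $A$ is an entry $a_{ij}=1$ with $i<j$. A feasible score sequence of length $n$ is an integer vector $R=(r_1,\ldots,r_n)$ with $r_1\le\cdots\le r_n$, $\sum_{i=1}^n r_i=\binom n2$ and $\sum_{i=1}^k r_i\ge\binom k2$ for $k=1,\ldots,n-1$. For such $R$ let $U_{\min}(R)$ be the set of those tournament matrices with row sum vector $R$ that have the minimum number of upsets among all tournament matrices with row sum vector $R$. Let $a_n$ be the number of feasible score sequences $R$ of length $n$ with $|U_{\min}(R)|=1$ (for $n=0$ the empty sequence counts, so $a_0=1$). **Theorem 1.5.** The sequence $(a_n)$ satisfies $$a_{n+3}-2a_{n+2}+a_n-a_{n-1}=0\qquad\text{for all } n\ge 1,$$ with $a_0=1$, $a_1=1$, $a_2=1$, $a_3=2$, $a_4=4$. The roots in $\mathbb C$, with multiplicity, of $x^4-2x^3+x-1$ are $$\frac{1\pm\sqrt{2\sqrt5+3}}2,\qquad \frac{1\pm i\sqrt{2\sqrt5-3}}2,$$ and for every $n\ge 1$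 $$a_n=c_1\left(\frac{1-\sqrt{2\sqrt5+3}}2\right)^{n-1}+c_2\left(\frac{1+\sqrt{2\sqrt5+3}}2\right)^{n-1}+c_3\left(\frac{1-i\sqrt{2\sqrt5-3}}2\right)^{n-1}+c_4\left(\frac{1+i\sqrt{2\sqrt5-3}}2\right)^{n-1},$$ where $$c_1=\frac{\sqrt5+1}4\left(\frac1{\sqrt5}-\frac1{\sqrt{2\sqrt5+3}}\right),\qquad c_2=\frac{\sqrt5+1}4\left(\frac1{\sqrt5}+\frac1{\sqrt{2\sqrt5+3}}\right),$$ $$c_3=\frac{\sqrt5-1}4\left(\frac1{\sqrt5}-\frac i{\sqrt{2\sqrt5-3}}\right),\qquad c_4=\frac{\sqrt5-1}4\left(\frac1{\sqrt5}+\frac i{\sqrt{2\sqrt5-3}}\right).$$ -/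

import Mathlib

open scoped BigOperators

namespace Tournament

/-- A tournament matrix: a (0,1)-matrix `A` with `A + Aᵀ = J - I`, where `J` is the all ones
matrix. -/
def IsTournamentMatrix {n : ℕ} (A : Matrix (Fin n) (Fin n) ℤ) : Prop :=
  (∀ i j, A i j = 0 ∨ A i j = 1) ∧ A + A.transpose = Matrix.of (fun _ _ => (1 : ℤ)) - 1

/-- The set of tournament matrices with row sum vector `R`. -/
def tournamentMatrices {n : ℕ} (R : Fin n → ℤ) : Set (Matrix (Fin n) (Fin n) ℤ) :=
  {A | IsTournamentMatrix A ∧ ∀ i, ∑ j, A i j = R i}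

/-- A feasible score sequence: a nondecreasing integral vector `R` of length `n` whose entries sum
to `n.choose 2`, satisfying the Landau inequalities for `k = 1, …, n - 1`. -/
def IsFeasible {n : ℕ} (R : Fin n → ℤ) : Prop :=
  Monotone R ∧ ∑ i, R i = (n.choose 2 : ℤ) ∧
    ∀ k : ℕ, 1 ≤ k → k < n →
      (k.choose 2 : ℤ) ≤ ∑ i ∈ Finset.univ.filter (fun i : Fin n => (i : ℕ) < k), R i

/-- The number of upsets of `A`: the number of entries equal to `1` above the main diagonal. -/
def upsets {n : ℕ} (A : Matrix (Fin n) (Fin n) ℤ) : ℕ :=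
  (Finset.univ.filter (fun p : Fin n × Fin n => p.1 < p.2 ∧ A p.1 p.2 = 1)).card

/-- `U_min(R)`: the tournament matrices with row sum vector `R` and the minimum number of upsets
among all of these. -/
def UMin {n : ℕ} (R : Fin n → ℤ) : Set (Matrix (Fin n) (Fin n) ℤ) :=
  {A | A ∈ tournamentMatrices R ∧ ∀ B ∈ tournamentMatrices R, upsets A ≤ upsets B}

/-- The number of feasible score sequences `R` of length `n` with `|U_min(R)| = 1`. -/
noncomputable def numUnique (n : ℕ) : ℕ :=
  Set.ncard {R : Fin n → ℤ | IsFeasible R ∧ Set.ncard (UMin R) = 1}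

/-- The real number `√(2√5 + 3)`, as a complex number. -/
noncomputable def sqrtPlus : ℂ := ((Real.sqrt (2 * Real.sqrt 5 + 3) : ℝ) : ℂ)

/-- The real number `√(2√5 - 3)`, as a complex number. -/
noncomputable def sqrtMinus : ℂ := ((Real.sqrt (2 * Real.sqrt 5 - 3) : ℝ) : ℂ)

/-- The real number `√5`, as a complex number. -/
noncomputable def sqrtFive : ℂ := ((Real.sqrt 5 : ℝ) : ℂ)

end Tournament

/-! Number the vertices from `0`. With no upsets the row sums are `0, 1, …, n - 1`, and an upset
`(i, j)` moves one point from `j` to `i`. Tournaments with row sums `R` are therefore edge sets of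
pairs `i < j` with imbalance `d i = R i - i`, and the question is when the smallest such set is
unique.

Necessity rests on exchanges: a unique minimum is transitive, and no two edges can be traded for two
others with the same imbalance. Comparing scores along an edge then rules out directed paths of
length two (`IsUniqueMin.not_path`), so every vertex that meets an edge is a pure source or a pure
sink. Between consecutive zeros of the partial sums of `d`, some source reaches every later negative
vertex. As `d` drops by at most one per step, an extremal estimate forces the shape `k, …, 1, 0, …,
0, -1, …, -k` (`IsUniqueMin.eq_stair`).

Sufficiency is linear programming duality: a linear potential on each block, with the blocks shifted
apart, gives the chosen pairs negative reduced cost and all other pairs positive reduced cost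
(`IsPotential.isUniqueMin`).

So `numUnique n` counts concatenations of blocks. The decomposition is unique, and shrinking the
first block yields the recurrence. Its characteristic polynomial splits over `ℚ(√5)` into two
quadratics in `x ^ 2 - x`, which gives the closed form. -/

namespace Tournament

/-! ### Upset sets as edge sets with prescribed imbalance -/

/-- The contribution of the pair `e` to the out-degree minus the in-degree of `v`. -/
def flow (e : ℕ × ℕ) (v : ℕ) : ℤ := (if e.1 = v then 1 else 0) - (if e.2 = v then 1 else 0)

/-- Out-degree minus in-degree of `v` in the digraph with edge set `E`. -/
def imbalance (E : Finset (ℕ × ℕ)) (v : ℕ) : ℤ := ∑ e ∈ E, flow e v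

/-- `E` consists of pairs `i < j < n` and has imbalance `d`. The set of upsets of a tournament
matrix with row sum vector `R` is such a set, for `d i = R i - i`. -/
structure IsUpsetSet (n : ℕ) (d : ℕ → ℤ) (E : Finset (ℕ × ℕ)) : Prop where
  lt : ∀ e ∈ E, e.1 < e.2
  bound : ∀ e ∈ E, e.2 < n
  imb : ∀ v < n, imbalance E v = d v

/-- `E` is the only upset set of minimum size. -/
def IsUniqueMin (n : ℕ) (d : ℕ → ℤ) (E : Finset (ℕ × ℕ)) : Prop :=
  IsUpsetSet n d E ∧ ∀ F, IsUpsetSet n d F → F ≠ E → E.card < F.card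

lemma imbalance_eq_sum_range {n : ℕ} {E : Finset (ℕ × ℕ)} (h : ∀ e ∈ E, e.1 < n ∧ e.2 < n)
    (v : ℕ) : imbalance E v = ∑ x ∈ Finset.range n,
      ((if (v, x) ∈ E then (1 : ℤ) else 0) - (if (x, v) ∈ E then 1 else 0)) := by
  have key : ∀ f : ℕ × ℕ → ℤ, ∑ e ∈ E, f e =
      ∑ a ∈ Finset.range n, ∑ b ∈ Finset.range n, if (a, b) ∈ E then f (a, b) else 0 := by
    intro f
    rw [← Finset.sum_product', ← Finset.sum_filter]
    refine Finset.sum_congr ?_ fun _ _ => rfl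
    ext e
    simp only [Finset.mem_filter, Finset.mem_product, Finset.mem_range]
    exact ⟨fun he => ⟨h e he, he⟩, fun he => he.2⟩
  unfold imbalance flow
  rw [Finset.sum_sub_distrib, Finset.sum_sub_distrib]
  congr 1
  · rw [key]
    by_cases hv : v < n
    · rw [Finset.sum_eq_single v]
      · simp
      · intro a _ ha
        simp [ha]
      · simp [hv]
    · rw [Finset.sum_eq_zero, Finset.sum_eq_zero]
      · intro x _
        rw [if_neg fun hx => hv (h _ hx).1]
      · intro a ha
        have : a ≠ v := by rintro rfl; exact hv (Finset.mem_range.1 ha)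
        simp [this]
  · rw [key, Finset.sum_comm]
    by_cases hv : v < n
    · rw [Finset.sum_eq_single v]
      · simp
      · intro a _ ha
        simp [ha]
      · simp [hv]
    · rw [Finset.sum_eq_zero, Finset.sum_eq_zero]
      · intro x _
        rw [if_neg fun hx => hv (h _ hx).2]
      · intro a ha
        have : a ≠ v := by rintro rfl; exact hv (Finset.mem_range.1 ha)
        simp [this]

/-- Summation by parts. With `φ` the indicator of an initial segment it counts the edges across a
cut; with `φ` a potential it shows that the total potential drop depends only on `d`. -/
lemma sum_imbalance_mul {K : Type*} [CommRing K] {n : ℕ} {E : Finset (ℕ × ℕ)}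
    (h : ∀ e ∈ E, e.1 < n ∧ e.2 < n) (φ : ℕ → K) :
    ∑ v ∈ Finset.range n, (imbalance E v : K) * φ v = ∑ e ∈ E, (φ e.1 - φ e.2) := by
  simp only [imbalance, Int.cast_sum, Finset.sum_mul]
  rw [Finset.sum_comm]
  refine Finset.sum_congr rfl fun e he => ?_
  simp only [flow, Int.cast_sub, Int.cast_ite, Int.cast_one, Int.cast_zero, sub_mul, ite_mul,
    one_mul, zero_mul, Finset.sum_sub_distrib, Finset.sum_ite_eq, Finset.mem_range, (h e he).1,
    (h e he).2, if_true]

namespace IsUpsetSet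

variable {n : ℕ} {d : ℕ → ℤ} {E : Finset (ℕ × ℕ)}

lemma bounds (h : IsUpsetSet n d E) : ∀ e ∈ E, e.1 < n ∧ e.2 < n := fun e he =>
  ⟨(h.lt e he).trans (h.bound e he), h.bound e he⟩

lemma eq_sum_range (h : IsUpsetSet n d E) {v : ℕ} (hv : v < n) : d v = ∑ x ∈ Finset.range n,
      ((if (v, x) ∈ E then (1 : ℤ) else 0) - (if (x, v) ∈ E then 1 else 0)) := by
  rw [← h.imb v hv, imbalance_eq_sum_range h.bounds]

/-- The number of edges across a cut is a partial sum of `d`. -/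
lemma sum_range_eq_card (h : IsUpsetSet n d E) {k : ℕ} (hk : k ≤ n) :
    ∑ v ∈ Finset.range k, d v = ((E.filter fun e => e.1 < k ∧ k ≤ e.2).card : ℤ) := by
  have := sum_imbalance_mul h.bounds (fun v => if v < k then (1 : ℤ) else 0)
  rw [Finset.card_filter, Nat.cast_sum]
  calc _ = ∑ v ∈ Finset.range n, (imbalance E v : ℤ) * (if v < k then (1 : ℤ) else 0) := by
        simp only [mul_ite, mul_one, mul_zero]
        rw [← Finset.sum_filter]
        refine Finset.sum_congr ?_ fun v hv => ?_
        · ext v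
          simp only [Finset.mem_range, Finset.mem_filter]
          omega
        · simp only [Finset.mem_filter, Finset.mem_range] at hv
          simp [h.imb v hv.1]
    _ = _ := by
        simp only [Int.cast_id] at this ⊢
        rw [this]
        refine Finset.sum_congr rfl fun e he => ?_
        have := h.lt e he
        split_ifs <;> simp <;> omega

lemma sum_range_nonneg (h : IsUpsetSet n d E) {k : ℕ} (hk : k ≤ n) :
    0 ≤ ∑ v ∈ Finset.range k, d v := by
  rw [h.sum_range_eq_card hk]
  positivity

lemma sum_range_eq_zero (h : IsUpsetSet n d E) : ∑ v ∈ Finset.range n, d v = 0 := by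
  rw [h.sum_range_eq_card le_rfl, Finset.filter_false_of_mem]
  · simp
  · intro e he
    have := h.bound e he
    omega

lemma no_crossing (h : IsUpsetSet n d E) {k : ℕ} (hk : k ≤ n)
    (h0 : ∑ v ∈ Finset.range k, d v = 0) {i j : ℕ} (he : (i, j) ∈ E) (hi : i < k) : j < k := by
  rw [h.sum_range_eq_card hk] at h0
  by_contra hj
  have h1 : E.filter (fun e => e.1 < k ∧ k ≤ e.2) = ∅ := by
    rw [← Finset.card_eq_zero]
    exact_mod_cast h0
  have : (i, j) ∈ E.filter (fun e => e.1 < k ∧ k ≤ e.2) := by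
    simp [he, hi]
    omega
  simp [h1] at this

end IsUpsetSet

/-! ### Correspondence between tournament matrices and upset sets -/

section Matrices

variable {n : ℕ}

/-- The matrix of the tournament whose set of upsets is `E`. -/
def matrixOf (n : ℕ) (E : Finset (ℕ × ℕ)) : Matrix (Fin n) (Fin n) ℤ := fun i j =>
  (if (j : ℕ) < i then 1 else 0) +
    ((if ((i : ℕ), (j : ℕ)) ∈ E then 1 else 0) - (if ((j : ℕ), (i : ℕ)) ∈ E then 1 else 0))

/-- The pairs `i < j` with `A i j = 1`. -/
def upsetSet (A : Matrix (Fin n) (Fin n) ℤ) : Finset (ℕ × ℕ) :=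
  (Finset.univ.filter (fun p : Fin n × Fin n => p.1 < p.2 ∧ A p.1 p.2 = 1)).map
    (Fin.valEmbedding.prodMap Fin.valEmbedding)

lemma card_upsetSet (A : Matrix (Fin n) (Fin n) ℤ) : (upsetSet A).card = upsets A := by
  simp [upsetSet, upsets]

lemma mem_upsetSet {A : Matrix (Fin n) (Fin n) ℤ} {i j : Fin n} :
    ((i : ℕ), (j : ℕ)) ∈ upsetSet A ↔ i < j ∧ A i j = 1 := by
  simp only [upsetSet, Finset.mem_map, Finset.mem_filter, Finset.mem_univ, true_and]
  constructor
  · rintro ⟨⟨a, b⟩, h, he⟩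
    simp only [Function.Embedding.prodMap, Function.Embedding.coeFn_mk, Prod.map,
      Fin.valEmbedding_apply, Prod.mk.injEq, Fin.val_inj] at he
    obtain ⟨rfl, rfl⟩ := he
    exact h
  · intro h
    exact ⟨(i, j), h, rfl⟩

lemma exists_of_mem_upsetSet {A : Matrix (Fin n) (Fin n) ℤ} {e : ℕ × ℕ} (he : e ∈ upsetSet A) :
    ∃ i j : Fin n, e = ((i : ℕ), (j : ℕ)) ∧ i < j := by
  simp only [upsetSet, Finset.mem_map, Finset.mem_filter, Finset.mem_univ, true_and] at he
  obtain ⟨⟨a, b⟩, h, rfl⟩ := he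
  exact ⟨a, b, rfl, h.1⟩

lemma IsTournamentMatrix.add_eq {A : Matrix (Fin n) (Fin n) ℤ} (h : IsTournamentMatrix A)
    (i j : Fin n) : A i j + A j i = if i = j then 0 else 1 := by
  have := congrFun (congrFun h.2 i) j
  simp only [Matrix.add_apply, Matrix.transpose_apply, Matrix.sub_apply, Matrix.of_apply,
    Matrix.one_apply] at this
  rw [this]
  split_ifs <;> simp

lemma matrixOf_upsetSet {A : Matrix (Fin n) (Fin n) ℤ} (h : IsTournamentMatrix A) :
    matrixOf n (upsetSet A) = A := by
  ext i j
  simp only [matrixOf, mem_upsetSet]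
  have h1 := h.add_eq i j
  rcases lt_trichotomy i j with hij | rfl | hij
  · have h2 : ¬ j < i := by omega
    have h3 : ¬ (j : ℕ) < i := by omega
    simp only [h2, h3, hij, false_and, true_and, if_false]
    rcases h.1 i j with h0 | h0 <;> simp [h0]
  · simp at h1 ⊢
    omega
  · have h2 : ¬ i < j := by omega
    have h3 : (j : ℕ) < i := by omega
    have h4 : i ≠ j := by omega
    simp only [h2, h3, hij, false_and, true_and, if_false, if_true]
    simp only [h4, if_false] at h1
    rcases h.1 j i with h0 | h0
    · simp [h0]; omega
    · simp [h0]; omega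

lemma isTournamentMatrix_matrixOf {E : Finset (ℕ × ℕ)} (hE : ∀ e ∈ E, e.1 < e.2) :
    IsTournamentMatrix (matrixOf n E) := by
  have h : ∀ i j : ℕ, (i, j) ∈ E → i < j := fun i j hij => hE _ hij
  constructor
  · intro i j
    have h1 := h i j
    have h2 := h j i
    simp only [matrixOf]
    split_ifs <;> grind
  · ext i j
    simp only [Matrix.add_apply, Matrix.transpose_apply, Matrix.sub_apply, Matrix.of_apply,
      Matrix.one_apply, matrixOf, Fin.ext_iff]
    have h1 := h i j
    have h2 := h j i
    split_ifs <;> grind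

lemma upsetSet_matrixOf {E : Finset (ℕ × ℕ)} (hE : ∀ e ∈ E, e.1 < e.2)
    (hn : ∀ e ∈ E, e.2 < n) : upsetSet (matrixOf n E) = E := by
  have h : ∀ i j : ℕ, (i, j) ∈ E → i < j := fun i j hij => hE _ hij
  ext e
  constructor
  · intro he
    obtain ⟨i, j, rfl, hij⟩ := exists_of_mem_upsetSet he
    rw [mem_upsetSet] at he
    have h3 : ¬ (j : ℕ) < i := by omega
    have h2 := h j i
    have := he.2
    simp only [matrixOf] at this
    by_contra hne
    rw [if_neg h3, if_neg hne, if_neg fun h' => h3 (h2 h')] at this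
    simp at this
  · obtain ⟨i, j⟩ := e
    intro he
    have hj := hn _ he
    have hij := h _ _ he
    have := @mem_upsetSet n (matrixOf n E) ⟨i, hij.trans hj⟩ ⟨j, hj⟩
    simp only at this
    rw [this]
    refine ⟨hij, ?_⟩
    have h3 : ¬ j < i := by omega
    simp only [matrixOf]
    rw [if_neg h3, if_pos he, if_neg fun h' => h3 (h _ _ h')]
    simp

lemma sum_matrixOf {E : Finset (ℕ × ℕ)} (hE : ∀ e ∈ E, e.1 < n ∧ e.2 < n) (i : Fin n) :
    ∑ j, matrixOf n E i j = i + imbalance E i := by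
  simp only [matrixOf]
  rw [Finset.sum_add_distrib, imbalance_eq_sum_range hE,
    ← Fin.sum_univ_eq_sum_range (fun x => (if ((i : ℕ), x) ∈ E then (1 : ℤ) else 0) -
      (if (x, (i : ℕ)) ∈ E then 1 else 0))]
  congr 1
  rw [Fin.sum_univ_eq_sum_range (fun x => if x < (i : ℕ) then (1 : ℤ) else 0),
    ← Finset.sum_filter]
  have : (Finset.range n).filter (fun x => x < (i : ℕ)) = Finset.range i := by
    ext x
    simp only [Finset.mem_filter, Finset.mem_range]
    omega
  simp [this]

lemma matrixOf_mem_tournamentMatrices {R : Fin n → ℤ} {d : ℕ → ℤ}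
    (hd : ∀ i : Fin n, d i = R i - i) {E : Finset (ℕ × ℕ)} (hE : IsUpsetSet n d E) :
    matrixOf n E ∈ tournamentMatrices R := by
  refine ⟨isTournamentMatrix_matrixOf hE.lt, fun i => ?_⟩
  rw [sum_matrixOf hE.bounds, hE.imb _ i.2, hd]
  ring

lemma isUpsetSet_upsetSet {R : Fin n → ℤ} {d : ℕ → ℤ} (hd : ∀ i : Fin n, d i = R i - i)
    {A : Matrix (Fin n) (Fin n) ℤ} (hA : A ∈ tournamentMatrices R) :
    IsUpsetSet n d (upsetSet A) := by
  have h1 : ∀ e ∈ upsetSet A, e.1 < e.2 := by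
    intro e he
    obtain ⟨i, j, rfl, hij⟩ := exists_of_mem_upsetSet he
    exact hij
  have h2 : ∀ e ∈ upsetSet A, e.2 < n := by
    intro e he
    obtain ⟨i, j, rfl, hij⟩ := exists_of_mem_upsetSet he
    exact j.2
  refine ⟨h1, h2, fun v hv => ?_⟩
  have := sum_matrixOf (n := n) (fun e he => ⟨(h1 e he).trans (h2 e he), h2 e he⟩) ⟨v, hv⟩
  rw [matrixOf_upsetSet hA.1, hA.2] at this
  have h3 := hd ⟨v, hv⟩
  simp only at this h3
  omega

lemma ncard_uMin_eq_one_iff {R : Fin n → ℤ} {d : ℕ → ℤ} (hd : ∀ i : Fin n, d i = R i - i) :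
    (UMin R).ncard = 1 ↔ ∃ E, IsUniqueMin n d E := by
  rw [Set.ncard_eq_one]
  constructor
  · rintro ⟨A, hA⟩
    have hA' : A ∈ UMin R := by simp [hA]
    refine ⟨upsetSet A, isUpsetSet_upsetSet hd hA'.1, fun F hF hne => ?_⟩
    have hB := matrixOf_mem_tournamentMatrices hd hF
    have hle := hA'.2 _ hB
    have hUF := upsetSet_matrixOf hF.lt hF.bound
    rw [card_upsetSet, ← hUF, card_upsetSet]
    refine lt_of_le_of_ne hle fun heq => hne ?_
    have : matrixOf n F ∈ UMin R := ⟨hB, fun C hC => heq ▸ hA'.2 C hC⟩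
    rw [hA, Set.mem_singleton_iff] at this
    rw [← hUF, this]
  · rintro ⟨E, hE, hmin⟩
    have hUE := upsetSet_matrixOf hE.lt hE.bound
    refine ⟨matrixOf n E, Set.eq_singleton_iff_unique_mem.2
      ⟨⟨matrixOf_mem_tournamentMatrices hd hE, fun B hB => ?_⟩, fun B hB => ?_⟩⟩
    · rw [← card_upsetSet, ← card_upsetSet, hUE]
      by_cases h : upsetSet B = E
      · rw [h]
      · exact (hmin _ (isUpsetSet_upsetSet hd hB) h).le
    · by_contra hne
      have h1 : upsetSet B ≠ E := by
        rintro rfl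
        exact hne (matrixOf_upsetSet hB.1.1).symm
      have h2 := hmin _ (isUpsetSet_upsetSet hd hB.1) h1
      have h3 := hB.2 _ (matrixOf_mem_tournamentMatrices hd hE)
      rw [← card_upsetSet, ← card_upsetSet, hUE] at h3
      omega

end Matrices

/-! ### Exchange arguments in a unique minimum -/

lemma imbalance_insert {E : Finset (ℕ × ℕ)} {e : ℕ × ℕ} (he : e ∉ E) (v : ℕ) :
    imbalance (insert e E) v = flow e v + imbalance E v := Finset.sum_insert he

lemma imbalance_erase {E : Finset (ℕ × ℕ)} {e : ℕ × ℕ} (he : e ∈ E) (v : ℕ) :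
    imbalance (E.erase e) v = imbalance E v - flow e v := by
  rw [eq_sub_iff_add_eq]
  exact Finset.sum_erase_add E _ he

namespace IsUniqueMin

variable {n : ℕ} {d : ℕ → ℤ} {E : Finset (ℕ × ℕ)}

/-- Two edges cannot be traded for two others with the same imbalance. -/
lemma false_of_exchange (h : IsUniqueMin n d E) {a b c e : ℕ × ℕ} (ha : a ∈ E) (hb : b ∈ E)
    (hab : a ≠ b) (hc : c ∉ E) (he : e ∉ E) (hce : c ≠ e) (hc1 : c.1 < c.2) (he1 : e.1 < e.2)
    (hc2 : c.2 < n) (he2 : e.2 < n) (hf : ∀ v, flow a v + flow b v = flow c v + flow e v) :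
    False := by
  set G := (E.erase a).erase b with hG
  have hbE : b ∈ E.erase a := Finset.mem_erase.2 ⟨hab.symm, hb⟩
  have hGE : ∀ x, x ∈ G → x ∈ E := fun x hx => Finset.mem_of_mem_erase (Finset.mem_of_mem_erase hx)
  have heG : e ∉ G := fun hx => he (hGE _ hx)
  have hcG : c ∉ insert e G := by
    rw [Finset.mem_insert]
    rintro (hx | hx)
    · exact hce hx
    · exact hc (hGE _ hx)
  have hF : IsUpsetSet n d (insert c (insert e G)) := by
    refine ⟨?_, ?_, ?_⟩
    · intro x hx
      rw [Finset.mem_insert, Finset.mem_insert] at hx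
      rcases hx with rfl | rfl | hx
      exacts [hc1, he1, h.1.lt _ (hGE _ hx)]
    · intro x hx
      rw [Finset.mem_insert, Finset.mem_insert] at hx
      rcases hx with rfl | rfl | hx
      exacts [hc2, he2, h.1.bound _ (hGE _ hx)]
    · intro v hv
      rw [imbalance_insert hcG, imbalance_insert heG, imbalance_erase hbE, imbalance_erase ha,
        h.1.imb v hv]
      linarith [hf v]
  have hcard : (insert c (insert e G)).card = E.card := by
    rw [Finset.card_insert_of_notMem hcG, Finset.card_insert_of_notMem heG,
      Finset.card_erase_of_mem hbE, Finset.card_erase_of_mem ha]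
    have : 1 < E.card := Finset.one_lt_card.2 ⟨a, ha, b, hb, hab⟩
    omega
  have hne : insert c (insert e G) ≠ E := by
    intro heq
    exact hc (heq ▸ Finset.mem_insert_self _ _)
  exact absurd (h.2 _ hF hne) (by omega)

/-- Otherwise the shortcut `(i, l)` could replace the path through `j`, keeping the imbalance and
saving an edge. -/
lemma trans_mem (h : IsUniqueMin n d E) {i j l : ℕ} (hij : (i, j) ∈ E) (hjl : (j, l) ∈ E) :
    (i, l) ∈ E := by
  by_contra hil
  have h1 := h.1.lt _ hij
  have h2 := h.1.lt _ hjl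
  have h3 := h.1.bound _ hjl
  simp only at h1 h2 h3
  set G := (E.erase (i, j)).erase (j, l) with hG
  have hbE : (j, l) ∈ E.erase (i, j) := Finset.mem_erase.2 ⟨by simp; omega, hjl⟩
  have hGE : ∀ x, x ∈ G → x ∈ E := fun x hx => Finset.mem_of_mem_erase (Finset.mem_of_mem_erase hx)
  have hcG : (i, l) ∉ G := fun hx => hil (hGE _ hx)
  have hF : IsUpsetSet n d (insert (i, l) G) := by
    refine ⟨?_, ?_, ?_⟩
    · intro x hx
      rw [Finset.mem_insert] at hx
      rcases hx with rfl | hx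
      exacts [h1.trans h2, h.1.lt _ (hGE _ hx)]
    · intro x hx
      rw [Finset.mem_insert] at hx
      rcases hx with rfl | hx
      exacts [h3, h.1.bound _ (hGE _ hx)]
    · intro v hv
      rw [imbalance_insert hcG, imbalance_erase hbE, imbalance_erase hij, h.1.imb v hv]
      simp only [flow]
      ring
  have hcard : (insert (i, l) G).card < E.card := by
    rw [Finset.card_insert_of_notMem hcG, Finset.card_erase_of_mem hbE,
      Finset.card_erase_of_mem hij]
    have : 1 < E.card := Finset.one_lt_card.2 ⟨_, hij, _, hjl, by simp; omega⟩
    omega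
  have hne : insert (i, l) G ≠ E := by
    intro heq
    exact hil (heq ▸ Finset.mem_insert_self _ _)
  exact absurd (h.2 _ hF hne) (by omega)

/-- A path of length two cannot be rerouted. -/
lemma mem_or_mem_of_path (h : IsUniqueMin n d E) {i j l x : ℕ} (hij : (i, j) ∈ E)
    (hjl : (j, l) ∈ E) (hix : i < x) (hxl : x < l) : (i, x) ∈ E ∨ (x, l) ∈ E := by
  by_contra hcon
  rw [not_or] at hcon
  have h1 := h.1.lt _ hij
  have h2 := h.1.lt _ hjl
  have h3 := h.1.bound _ hjl
  simp only at h1 h2 h3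
  refine h.false_of_exchange hij hjl (by simp; omega) hcon.1 hcon.2 (by simp; omega) hix hxl
    (hxl.trans h3) h3 fun v => ?_
  simp only [flow]
  ring

/-- The heads of two edges cannot be interchanged. -/
lemma mem_or_mem_of_swap (h : IsUniqueMin n d E) {i j l m : ℕ} (hil : (i, l) ∈ E)
    (hjm : (j, m) ∈ E) (hij : i ≠ j) (him : i < m) (hjl : j < l) :
    (i, m) ∈ E ∨ (j, l) ∈ E := by
  by_contra hcon
  rw [not_or] at hcon
  have h3 := h.1.bound _ hil
  have h4 := h.1.bound _ hjm
  simp only at h3 h4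
  refine h.false_of_exchange hil hjm (by simp [hij]) hcon.1 hcon.2 (by simp [hij]) him hjl h4 h3
    fun v => ?_
  simp only [flow]
  ring

/-- Comparison of the scores of the ends of an edge. -/
lemma card_add_card_lt (h : IsUniqueMin n d E) {i j : ℕ} (hij : (i, j) ∈ E)
    (hd : d i + i ≤ d j + j) :
    ((Finset.range n).filter fun y => j < y ∧ (i, y) ∈ E ∧ (j, y) ∉ E).card +
      ((Finset.range n).filter fun y => y < i ∧ (y, j) ∈ E ∧ (y, i) ∉ E).card <
      ((Finset.range n).filter fun x => i < x ∧ x < j ∧ (i, x) ∉ E ∧ (x, j) ∉ E).card := by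
  have hlt : ∀ a b : ℕ, (a, b) ∈ E → a < b := fun a b hab => h.1.lt _ hab
  have hi := (h.1.bounds _ hij).1
  have hj := (h.1.bounds _ hij).2
  have hl := hlt _ _ hij
  simp only at hi hj
  have h1 : ((j : ℤ) - i) =
      ∑ x ∈ Finset.range n, (if i ≤ x ∧ x < j then (1 : ℤ) else 0) := by
    rw [← Finset.sum_filter]
    have : (Finset.range n).filter (fun x => i ≤ x ∧ x < j) = Finset.Ico i j := by
      ext x
      simp only [Finset.mem_filter, Finset.mem_range, Finset.mem_Ico]
      omega
    rw [this]
    simp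
    omega
  have h2 : (1 : ℤ) = ∑ x ∈ Finset.range n, (if x = j then (1 : ℤ) else 0) := by
    rw [Finset.sum_ite_eq' (Finset.range n) j]
    simp [hj]
  rw [← Nat.cast_lt (α := ℤ), Nat.cast_add]
  simp only [Finset.card_filter, Nat.cast_sum, Nat.cast_ite, Nat.cast_one, Nat.cast_zero]
  rw [← sub_pos, ← Int.add_one_le_iff, zero_add]
  rw [h.1.eq_sum_range hi, h.1.eq_sum_range hj] at hd
  have h0 : (0 : ℤ) ≤ ∑ x ∈ Finset.range n,
      (((if (j, x) ∈ E then (1 : ℤ) else 0) - (if (x, j) ∈ E then 1 else 0)) -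
      ((if (i, x) ∈ E then (1 : ℤ) else 0) - (if (x, i) ∈ E then 1 else 0)) +
      (if i ≤ x ∧ x < j then (1 : ℤ) else 0)) := by
    rw [Finset.sum_add_distrib, Finset.sum_sub_distrib, ← h1]
    linarith
  rw [← Finset.sum_add_distrib, ← Finset.sum_sub_distrib]
  conv_lhs => rw [h2]
  rw [← sub_nonneg, ← Finset.sum_sub_distrib]
  -- The score difference is bounded vertex by vertex. Outside `[i, j]` transitivity leaves only the
  -- two counts on the left of the claim. Strictly between, `1` minus the number of edges `(i, x)`,
  -- `(x, j)` is positive only if both are missing. At `x = i` the contribution is `0` and at `x =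
  -- j` it is `-1`, whence the strict inequality.
  refine h0.trans (Finset.sum_le_sum fun x _ => ?_)
  have e1 := hlt i x
  have e2 := hlt x i
  have e3 := hlt j x
  have e4 := hlt x j
  have t1 : (j, x) ∈ E → (i, x) ∈ E := fun hx => h.trans_mem hij hx
  have t2 : (x, i) ∈ E → (x, j) ∈ E := fun hx => h.trans_mem hx hij
  have t3 : x = j → (i, x) ∈ E := fun hx => hx ▸ hij
  have t4 : x = i → (x, j) ∈ E := fun hx => hx ▸ hij
  clear h0 h1 h2 hd hlt
  split_ifs <;> grind

/-- In a tournament with the unique minimum number of upsets, no upset follows another. -/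
lemma not_path (h : IsUniqueMin n d E) (hd : ∀ i j, i ≤ j → j < n → d i + i ≤ d j + j)
    {i j l : ℕ} (hij : (i, j) ∈ E) : (j, l) ∉ E := by
  intro hjl
  have h1 := h.1.lt _ hij
  have h2 := h.1.lt _ hjl
  have h3 := h.1.bound _ hjl
  simp only at h1 h2 h3
  have c1 := h.card_add_card_lt hij (hd _ _ h1.le (h2.trans h3))
  have c2 := h.card_add_card_lt hjl (hd _ _ h2.le h3)
  -- Rerouting `i → j → l` through `x` is impossible, so each vertex counted on the right for one
  -- edge is counted on the left for the other. The two strict inequalities then form a cycle.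
  have s1 : ((Finset.range n).filter fun x => i < x ∧ x < j ∧ (i, x) ∉ E ∧ (x, j) ∉ E).card ≤
      ((Finset.range n).filter fun y => y < j ∧ (y, l) ∈ E ∧ (y, j) ∉ E).card := by
    refine Finset.card_le_card fun x hx => ?_
    simp only [Finset.mem_filter] at hx ⊢
    obtain ⟨hx0, hx1, hx2, hx3, hx4⟩ := hx
    refine ⟨hx0, hx2, ?_, hx4⟩
    exact (h.mem_or_mem_of_path hij hjl hx1 (hx2.trans h2)).resolve_left hx3
  have s2 : ((Finset.range n).filter fun x => j < x ∧ x < l ∧ (j, x) ∉ E ∧ (x, l) ∉ E).card ≤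
      ((Finset.range n).filter fun y => j < y ∧ (i, y) ∈ E ∧ (j, y) ∉ E).card := by
    refine Finset.card_le_card fun x hx => ?_
    simp only [Finset.mem_filter] at hx ⊢
    obtain ⟨hx0, hx1, hx2, hx3, hx4⟩ := hx
    refine ⟨hx0, hx1, ?_, hx3⟩
    exact (h.mem_or_mem_of_path hij hjl (h1.trans hx1) hx2).resolve_right hx4
  omega

end IsUniqueMin

/-! ### Sequences that drop by at most one per step -/

lemma two_mul_sum_range_tsub {k N : ℕ} (h : k ≤ N) :
    2 * ∑ r ∈ Finset.range N, ((k - r : ℕ) : ℤ) = k * (k + 1) := by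
  have h1 : ∀ k : ℕ, 2 * ∑ r ∈ Finset.range k, ((k - r : ℕ) : ℤ) = k * (k + 1) := by
    intro k
    induction k with
    | zero => simp
    | succ k ih =>
      rw [Finset.sum_range_succ', mul_add]
      simp only [Nat.add_sub_add_right, ih]
      push_cast
      ring
  induction N, h using Nat.le_induction with
  | base => exact h1 k
  | succ N hN ih => simp [Finset.sum_range_succ, ih, Nat.sub_eq_zero_of_le hN]

/-- The entry `r` of the sequence `k, k-1, …, 1, 0, …, 0, -1, …, -k` of length `m`. -/
def stair (k m r : ℕ) : ℤ := ((k - r : ℕ) : ℤ) - ((r + k + 1 - m : ℕ) : ℤ)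

section Sequences

variable {d : ℕ → ℤ} {u t : ℕ}

lemma sub_le_of_step (hstep : ∀ i, u ≤ i → i + 1 < t → d i - 1 ≤ d (i + 1)) (r : ℕ) :
    ∀ i, u ≤ i → i + r < t → d i - r ≤ d (i + r) := by
  induction r with
  | zero => simp
  | succ r ih =>
    intro i hi hr
    have h1 := ih i hi (by omega)
    have h2 := hstep (i + r) (by omega) (by omega)
    rw [← add_assoc]
    push_cast
    linarith

/-- The number of negative terms of `d` from `u` to `w`. -/
def negCount (d : ℕ → ℤ) (u w : ℕ) : ℤ := ∑ v ∈ Finset.Ico u (w + 1), if d v < 0 then 1 else 0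

lemma negCount_succ {w : ℕ} (hw : u ≤ w) :
    negCount d u (w + 1) = negCount d u w + if d (w + 1) < 0 then 1 else 0 :=
  Finset.sum_Ico_succ_top (by omega) _

lemma negCount_nonneg (w : ℕ) : 0 ≤ negCount d u w :=
  Finset.sum_nonneg fun v _ => by split_ifs <;> simp

/-- Starting from a nonnegative value, the sequence needs a new negative term for each further unit
of depth, so the `m`-th negative term is at least `-m`. Summing gives `-m (m + 1) / 2`, and equality
forces each of these bounds to be attained. -/
lemma sum_min_bound (hu : 0 ≤ d u) (hstep : ∀ i, u ≤ i → i + 1 < t → d i - 1 ≤ d (i + 1))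
    {w : ℕ} (huw : u ≤ w) (hwt : w < t) :
    -negCount d u w ≤ d w ∧
    -(negCount d u w * (negCount d u w + 1)) ≤ 2 * ∑ v ∈ Finset.Ico u (w + 1), min (d v) 0 ∧
    (-(negCount d u w * (negCount d u w + 1)) = 2 * ∑ v ∈ Finset.Ico u (w + 1), min (d v) 0 →
      ∀ v, u ≤ v → v ≤ w → d v < 0 → d v = -negCount d u v) := by
  induction w, huw using Nat.le_induction with
  | base =>
    have h1 : negCount d u u = 0 := by simp [negCount, hu]
    refine ⟨by rw [h1]; simpa using hu, by simp [h1, hu], fun _ v hv1 hv2 hv => ?_⟩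
    obtain rfl : v = u := by omega
    omega
  | succ w huw ih =>
    obtain ⟨ih1, ih2, ih3⟩ := ih (by omega)
    have hs := hstep w huw hwt
    have hn : 0 ≤ negCount d u w := negCount_nonneg w
    rw [Finset.sum_Ico_succ_top (by omega), mul_add]
    by_cases hneg : d (w + 1) < 0
    · have h1 : negCount d u (w + 1) = negCount d u w + 1 := by
        rw [negCount_succ huw, if_pos hneg]
      rw [min_eq_left hneg.le, h1]
      have h2 : -(negCount d u w + 1) ≤ d (w + 1) := by linarith
      refine ⟨h2, by nlinarith, fun heq v hv1 hv2 hv => ?_⟩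
      rcases Nat.lt_or_ge w v with hlt | hge
      · obtain rfl : v = w + 1 := by omega
        rw [h1]
        nlinarith
      · exact ih3 (by nlinarith) v hv1 hge hv
    · have h1 : negCount d u (w + 1) = negCount d u w := by
        rw [negCount_succ huw, if_neg hneg, add_zero]
      rw [min_eq_right (not_lt.1 hneg), h1]
      refine ⟨by linarith, by linarith, fun heq v hv1 hv2 hv => ?_⟩
      rcases Nat.lt_or_ge w v with hlt | hge
      · obtain rfl : v = w + 1 := by omega
        exact absurd hv hneg
      · exact ih3 (by linarith) v hv1 hge hv

/-- A sequence decreasing by at most one at each step, starting at `k > 0`, with at most `k`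
negative terms, the last term being one of them, has nonnegative sum; it is a staircase when the
sum is zero. -/
lemma sum_nonneg_and_eq_stair {k : ℕ} (hk : 1 ≤ k) (hut : u < t) (hu : d u = k)
    (hstep : ∀ i, u ≤ i → i + 1 < t → d i - 1 ≤ d (i + 1)) (hlast : d (t - 1) < 0)
    (hneg : ((Finset.Ico u t).filter fun v => d v < 0).card ≤ k) :
    0 ≤ ∑ v ∈ Finset.Ico u t, d v ∧
      (∑ v ∈ Finset.Ico u t, d v = 0 →
        2 * k < t - u ∧ ∀ r < t - u, d (u + r) = stair k (t - u) r) := by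
  -- The positive parts dominate `k, k - 1, …, 1`, and the negative parts sum to at least `-(1 + ⋯ +
  -- k)`. A zero sum makes both bounds equalities.
  have hA : ∀ r : ℕ, u + r < t → (k : ℤ) - r ≤ d (u + r) := fun r hr =>
    hu ▸ sub_le_of_step hstep r u le_rfl hr
  have hkt : u + k < t - 1 := by
    by_contra hcon
    have := hA (t - 1 - u) (by omega)
    rw [show u + (t - 1 - u) = t - 1 by omega] at this
    omega
  obtain ⟨w, rfl⟩ : ∃ w, t = w + 1 := ⟨t - 1, by omega⟩
  simp only [Nat.add_sub_cancel] at hlast hkt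
  have hm : negCount d u w ≤ k := by
    unfold negCount
    rw [← Finset.sum_filter]
    simpa using hneg
  have hm0 : 0 ≤ negCount d u w := negCount_nonneg w
  obtain ⟨-, hB, hB'⟩ := sum_min_bound (by omega) hstep (show u ≤ w by omega) (by omega)
  have hP : 2 * ∑ v ∈ Finset.Ico u (w + 1), ((u + k - v : ℕ) : ℤ) = k * (k + 1) := by
    rw [Finset.sum_Ico_eq_sum_range, ← two_mul_sum_range_tsub (show k ≤ w + 1 - u by omega)]
    congr 1
    refine Finset.sum_congr rfl fun r _ => ?_
    congr 1
    omega
  have hle : ∀ v ∈ Finset.Ico u (w + 1), ((u + k - v : ℕ) : ℤ) ≤ max (d v) 0 := by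
    intro v hv
    rw [Finset.mem_Ico] at hv
    have := hA (v - u) (by omega)
    rw [show u + (v - u) = v by omega] at this
    omega
  have hP' := Finset.sum_le_sum hle
  have hsplit : ∑ v ∈ Finset.Ico u (w + 1), d v =
      ∑ v ∈ Finset.Ico u (w + 1), max (d v) 0 + ∑ v ∈ Finset.Ico u (w + 1), min (d v) 0 := by
    rw [← Finset.sum_add_distrib]
    refine Finset.sum_congr rfl fun v _ => ?_
    omega
  have hmm : negCount d u w * (negCount d u w + 1) ≤ k * (k + 1) := by nlinarith
  refine ⟨by linarith, fun h0 => ?_⟩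
  have hmk : negCount d u w = k := by nlinarith
  have hN := hB' (by linarith)
  have hPeq := (Finset.sum_eq_sum_iff_of_le hle).1 (by linarith)
  -- The last term is now `-k`; going backwards the sequence rises by at most one per step, so the
  -- last `k` terms are negative. They use up all the negative terms.
  have hC : ∀ r ≤ k, negCount d u (w - r) = (k : ℤ) - r ∧ (r < k → d (w - r) < 0) := by
    have hd : ∀ r < k, d (w - r) < 0 := by
      intro r hr
      have h1 := sub_le_of_step hstep r (w - r) (by omega) (by omega)
      rw [show w - r + r = w by omega, hN w (by omega) le_rfl hlast, hmk] at h1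
      omega
    intro r hr
    refine ⟨?_, hd r⟩
    induction r with
    | zero => simpa using hmk
    | succ r ih =>
      have h1 := ih (by omega)
      have h2 : negCount d u (w - (r + 1) + 1) = _ := negCount_succ (by omega)
      rw [show w - (r + 1) + 1 = w - r by omega, if_pos (hd r (by omega)), h1] at h2
      push_cast
      linarith
  have hnonneg : ∀ v, u ≤ v → v ≤ w - k → 0 ≤ d v := by
    intro v hv1 hv2
    by_contra hcon
    have h1 := (hC k le_rfl).1
    rw [sub_self] at h1
    unfold negCount at h1
    rw [Finset.sum_eq_zero_iff_of_nonneg fun v _ => by split_ifs <;> simp] at h1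
    have := h1 v (Finset.mem_Ico.2 ⟨hv1, by omega⟩)
    rw [if_pos (not_le.1 hcon)] at this
    omega
  -- The term at `u + k` is nonnegative, so it lies before the negative tail of length `k`.
  have hlt : 2 * k < w + 1 - u := by
    by_contra hcon
    have h1 := hA k (by omega)
    have h2 := (hC (w - (u + k)) (by omega)).2 (by omega)
    rw [show w - (w - (u + k)) = u + k by omega] at h2
    omega
  refine ⟨hlt, fun r hr => ?_⟩
  have h1 := hPeq (u + r) (Finset.mem_Ico.2 (by omega))
  unfold stair
  rcases Nat.lt_or_ge (w - k) (u + r) with hlt' | hge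
  · have h2 := hC (w - (u + r)) (by omega)
    rw [show w - (w - (u + r)) = u + r by omega] at h2
    have h3 := hN (u + r) (by omega) (by omega) (h2.2 (by omega))
    rw [h2.1] at h3
    omega
  · have h2 := hnonneg (u + r) (by omega) hge
    omega

end Sequences

/-! ### Necessity: a unique minimum gives staircase blocks -/

/-- The sequence `k, …, 1, 0, …, 0, -1, …, -k` of length `m` is either the single `0`, or
has `k > 0` and at least one zero in the middle. -/
def IsBlock (k m : ℕ) : Prop := 2 * k < m ∧ (k = 0 → m = 1)

/-- Concatenations of staircase blocks. -/
inductive IsStairList : List ℤ → Prop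
  | nil : IsStairList []
  | append {k m : ℕ} {l : List ℤ} (hb : IsBlock k m) (hl : IsStairList l) :
      IsStairList ((List.range m).map (stair k m) ++ l)

lemma IsUpsetSet.exists_mem_of_neg {n : ℕ} {d : ℕ → ℤ} {E : Finset (ℕ × ℕ)}
    (h : IsUpsetSet n d E) {v : ℕ} (hv : v < n) (hd : d v < 0) : ∃ i, (i, v) ∈ E := by
  by_contra! hcon
  rw [h.eq_sum_range hv] at hd
  refine absurd hd (not_lt.2 (Finset.sum_nonneg fun x _ => ?_))
  rw [if_neg (hcon x)]
  split_ifs <;> simp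

namespace IsUniqueMin

variable {n : ℕ} {d : ℕ → ℤ} {E : Finset (ℕ × ℕ)}

lemma eq_card_of_mem (h : IsUniqueMin n d E)
    (hd : ∀ i j, i ≤ j → j < n → d i + i ≤ d j + j) {u c : ℕ} (huc : (u, c) ∈ E) :
    d u = ((Finset.range n).filter fun x => (u, x) ∈ E).card := by
  rw [h.1.eq_sum_range (h.1.bounds _ huc).1, Finset.card_filter, Nat.cast_sum]
  refine Finset.sum_congr rfl fun x _ => ?_
  rw [if_neg fun hx : (x, u) ∈ E => h.not_path hd hx huc]
  split_ifs <;> simp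

lemma pos_of_mem (h : IsUniqueMin n d E)
    (hd : ∀ i j, i ≤ j → j < n → d i + i ≤ d j + j) {u c : ℕ} (huc : (u, c) ∈ E) : 0 < d u := by
  rw [h.eq_card_of_mem hd huc]
  have : 0 < ((Finset.range n).filter fun x => (u, x) ∈ E).card :=
    Finset.card_pos.2 ⟨c, Finset.mem_filter.2 ⟨Finset.mem_range.2 (h.1.bounds _ huc).2, huc⟩⟩
  exact_mod_cast this

/-- By `not_path` the vertex `b` has no outgoing edge, so `-d b` is its in-degree. -/
lemma eq_of_mem_of_mem (h : IsUniqueMin n d E)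
    (hd : ∀ i j, i ≤ j → j < n → d i + i ≤ d j + j) {u i b : ℕ} (hub : (u, b) ∈ E)
    (hib : (i, b) ∈ E) (hb : d b = -1) : i = u := by
  have h1 : d b = -((Finset.range n).filter fun x => (x, b) ∈ E).card := by
    rw [h.1.eq_sum_range (h.1.bounds _ hub).2, Finset.card_filter, Nat.cast_sum,
      ← Finset.sum_neg_distrib]
    refine Finset.sum_congr rfl fun x _ => ?_
    rw [if_neg (h.not_path hd hub)]
    split_ifs <;> simp
  rw [hb] at h1
  have h2 : ((Finset.range n).filter fun x => (x, b) ∈ E).card = 1 := by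
    have := neg_inj.1 h1
    exact_mod_cast this.symm
  rw [Finset.card_eq_one] at h2
  obtain ⟨a, ha⟩ := h2
  have m1 : u ∈ (Finset.range n).filter fun x => (x, b) ∈ E :=
    Finset.mem_filter.2 ⟨Finset.mem_range.2 (h.1.bounds _ hub).1, hub⟩
  have m2 : i ∈ (Finset.range n).filter fun x => (x, b) ∈ E :=
    Finset.mem_filter.2 ⟨Finset.mem_range.2 (h.1.bounds _ hib).1, hib⟩
  rw [ha, Finset.mem_singleton] at m1 m2
  rw [m1, m2]

/-- Between consecutive zeros of its partial sums, `d` is a staircase. -/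
lemma eq_stair (h : IsUniqueMin n d E) (hd : ∀ i j, i ≤ j → j < n → d i + i ≤ d j + j)
    {s t : ℕ} (hst : s < t) (htn : t ≤ n) (hs : ∑ v ∈ Finset.range s, d v = 0)
    (ht : ∑ v ∈ Finset.range t, d v = 0)
    (hpos : ∀ j, s < j → j < t → ∑ v ∈ Finset.range j, d v ≠ 0) :
    ∃ k, IsBlock k (t - s) ∧ ∀ r < t - s, d (s + r) = stair k (t - s) r := by
  have hpos' : ∀ j, s < j → j < t → 0 < ∑ v ∈ Finset.range j, d v := fun j h1 h2 =>
    lt_of_le_of_ne (h.1.sum_range_nonneg (by omega)) (hpos j h1 h2).symm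
  rcases Nat.lt_or_ge (s + 1) t with hlt | hge
  swap
  · obtain rfl : t = s + 1 := by omega
    refine ⟨0, ⟨by omega, by omega⟩, fun r hr => ?_⟩
    obtain rfl : r = 0 := by omega
    rw [Finset.sum_range_succ, hs, zero_add] at ht
    simp [stair, ht]
  have hds : 0 < d s := by
    have := hpos' (s + 1) (by omega) hlt
    rwa [Finset.sum_range_succ, hs, zero_add] at this
  have hdt : d (t - 1) < 0 := by
    have h1 := hpos' (t - 1) (by omega) (by omega)
    have h2 : t = t - 1 + 1 := by omega
    rw [h2, Finset.sum_range_succ] at ht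
    linarith
  -- `q` is the last positive position of the block and `b` the first negative one after it. As `d`
  -- drops by at most one per step, `d b = -1`, so `b` has a single in-neighbour `u`.
  obtain ⟨q, hq, hqmax⟩ := Finset.exists_max_image ((Finset.Ico s t).filter fun v => 0 < d v) id
    ⟨s, by simp [hds, hst]⟩
  simp only [Finset.mem_filter, Finset.mem_Ico, id] at hq hqmax
  have hqt : q < t - 1 := by
    refine lt_of_le_of_ne (by omega) ?_
    rintro rfl
    omega
  obtain ⟨b, hb, hbmin⟩ := Finset.exists_min_image ((Finset.Ioo q t).filter fun v => d v < 0) id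
    ⟨t - 1, by simp [hdt]; omega⟩
  simp only [Finset.mem_filter, Finset.mem_Ioo, id] at hb hbmin
  have hb1 : d b = -1 := by
    have h1 : 0 ≤ d (b - 1) := by
      by_contra hcon
      rcases eq_or_ne (b - 1) q with heq | hne
      · rw [heq] at hcon
        omega
      · have := hbmin (b - 1) (by omega)
        omega
    have h2 := hd (b - 1) b (by omega) (by omega)
    rw [show ((b - 1 : ℕ) : ℤ) = b - 1 by omega] at h2
    omega
  have hsource : ∀ i c, (i, c) ∈ E → s ≤ c → c < t → s ≤ i ∧ i ≤ q := by
    intro i c hic hc1 hc2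
    have h1 := h.1.lt _ hic
    have h2 : s ≤ i := by
      by_contra hcon
      have := h.1.no_crossing (by omega) hs hic (by omega)
      omega
    exact ⟨h2, hqmax i ⟨⟨h2, by simp only at h1; omega⟩, h.pos_of_mem hd hic⟩⟩
  obtain ⟨u, hub⟩ := h.1.exists_mem_of_neg (by omega) hb.2
  have hu := hsource u b hub (by omega) (by omega)
  -- If `c` were reached from some `i` but not from `u`, interchanging the heads of `(u, b)` and
  -- `(i, c)` would be legitimate: `i ≤ q < b`, and `(i, b)` is not an edge because `u` is the only
  -- in-neighbour of `b`.
  have hall : ∀ c, u < c → c < t → d c < 0 → (u, c) ∈ E := by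
    intro c hc1 hc2 hc3
    by_contra hcon
    obtain ⟨i, hi⟩ := h.1.exists_mem_of_neg (by omega) hc3
    have hi' := hsource i c hi (by omega) hc2
    have hne : u ≠ i := by
      rintro rfl
      exact hcon hi
    rcases h.mem_or_mem_of_swap hub hi hne hc1 (by omega) with h1 | h1
    · exact hcon h1
    · exact hne (h.eq_of_mem_of_mem hd hub h1 hb1).symm
  have hdu := h.eq_card_of_mem hd hub
  have hdu0 := h.pos_of_mem hd hub
  set k := ((Finset.range n).filter fun x => (u, x) ∈ E).card with hk
  have hneg : ((Finset.Ico u t).filter fun v => d v < 0).card ≤ k := by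
    refine Finset.card_le_card fun c hc => ?_
    simp only [Finset.mem_filter, Finset.mem_Ico, Finset.mem_range] at hc ⊢
    refine ⟨by omega, hall c (lt_of_le_of_ne hc.1.1 ?_) hc.1.2 hc.2⟩
    rintro rfl
    omega
  obtain ⟨hnn, hst0⟩ := sum_nonneg_and_eq_stair (by omega) (by omega) hdu
    (fun i hi1 hi2 => by
      have := hd i (i + 1) (by omega) (by omega)
      push_cast at this
      linarith) hdt hneg
  have hsum := Finset.sum_range_add_sum_Ico d (show u ≤ t by omega)
  rw [ht] at hsum
  -- The sum over `[u, t)` is nonnegative and the sum up to `t` is zero, so the partial sum at `u`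
  -- is at most zero; inside the block it would be positive.
  obtain rfl : u = s := by
    by_contra hne
    have := hpos' u (by omega) (by omega)
    linarith
  obtain ⟨h1, h2⟩ := hst0 (by linarith)
  exact ⟨k, ⟨h1, by omega⟩, h2⟩

lemma isStairList_suffix (h : IsUniqueMin n d E)
    (hd : ∀ i j, i ≤ j → j < n → d i + i ≤ d j + j) (N : ℕ) :
    ∀ s ≤ n, n - s ≤ N → ∑ v ∈ Finset.range s, d v = 0 →
      IsStairList ((List.range (n - s)).map fun r => d (s + r)) := by
  induction N with
  | zero =>
    intro s hs hN _
    rw [show n - s = 0 by omega]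
    exact IsStairList.nil
  | succ N ih =>
    intro s hs hN h0
    rcases hs.eq_or_lt with rfl | hlt
    · rw [Nat.sub_self]
      exact IsStairList.nil
    -- The first block ends at the next zero of the partial sums.
    have hex : ∃ t, s < t ∧ ∑ v ∈ Finset.range t, d v = 0 := ⟨n, hlt, h.1.sum_range_eq_zero⟩
    classical
    obtain ⟨hst, ht⟩ := Nat.find_spec hex
    have htn : Nat.find hex ≤ n := Nat.find_min' hex ⟨hlt, h.1.sum_range_eq_zero⟩
    have hmin : ∀ j, s < j → j < Nat.find hex → ∑ v ∈ Finset.range j, d v ≠ 0 :=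
      fun j hj1 hj2 h0 => Nat.find_min hex hj2 ⟨hj1, h0⟩
    set t := Nat.find hex
    obtain ⟨k, hb, hk⟩ := h.eq_stair hd hst htn h0 ht hmin
    have := IsStairList.append hb (ih t htn (by omega) ht)
    convert this using 1
    rw [show n - s = (t - s) + (n - t) by omega, List.range_add, List.map_append, List.map_map]
    congr 1
    · refine List.map_congr_left fun r hr => hk r (List.mem_range.1 hr)
    · refine List.map_congr_left fun r _ => ?_
      simp only [Function.comp]
      congr 1
      omega

lemma isStairList (h : IsUniqueMin n d E)
    (hd : ∀ i j, i ≤ j → j < n → d i + i ≤ d j + j) : IsStairList ((List.range n).map d) := by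
  simpa using h.isStairList_suffix hd n 0 (by omega) (by omega) (by simp)

end IsUniqueMin

/-! ### Sufficiency: potentials certify a unique minimum -/

/-- The pairs `i < j < n` with `ψ j - ψ i > 1` have imbalance `d`, and `ψ j - ψ i` is never `1`:
such a `ψ` certifies that these pairs are the unique minimum upset set. -/
def IsPotential (n : ℕ) (d : ℕ → ℤ) (ψ : ℕ → ℚ) : Prop :=
  (∀ i j, i < j → j < n → ψ j - ψ i ≠ 1) ∧ ∀ v < n, d v = ∑ x ∈ Finset.range n,
    ((if v < x ∧ 1 < ψ x - ψ v then (1 : ℤ) else 0) - if x < v ∧ 1 < ψ v - ψ x then 1 else 0)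

lemma IsPotential.isUniqueMin {n : ℕ} {d : ℕ → ℤ} {ψ : ℕ → ℚ} (h : IsPotential n d ψ) :
    IsUniqueMin n d ((Finset.range n ×ˢ Finset.range n).filter
      fun e => e.1 < e.2 ∧ 1 < ψ e.2 - ψ e.1) := by
  set E := (Finset.range n ×ˢ Finset.range n).filter
      fun e => e.1 < e.2 ∧ 1 < ψ e.2 - ψ e.1 with hE
  have hmem : ∀ e, e ∈ E ↔ (e.1 < n ∧ e.2 < n) ∧ e.1 < e.2 ∧ 1 < ψ e.2 - ψ e.1 := by
    intro e
    simp [hE]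
  have hU : IsUpsetSet n d E := by
    refine ⟨fun e he => ((hmem e).1 he).2.1, fun e he => ((hmem e).1 he).1.2, fun v hv => ?_⟩
    rw [imbalance_eq_sum_range fun e he => ((hmem e).1 he).1, h.2 v hv]
    refine Finset.sum_congr rfl fun x hx => ?_
    simp only [hmem, hv, Finset.mem_range.1 hx, true_and]
  refine ⟨hU, fun F hF hne => ?_⟩
  -- The reduced cost of a set is its size plus a constant depending only on `d` and `ψ`. The set
  -- `E` consists of exactly the pairs of negative reduced cost, and no pair has reduced cost zero.
  have hw : ∀ G, IsUpsetSet n d G → ∑ e ∈ G, (1 - (ψ e.2 - ψ e.1)) =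
      (G.card : ℚ) + ∑ v ∈ Finset.range n, (d v : ℚ) * ψ v := by
    intro G hG
    have h1 := sum_imbalance_mul hG.bounds ψ
    rw [Finset.sum_congr rfl fun v hv => by rw [hG.imb v (Finset.mem_range.1 hv)]] at h1
    rw [h1, Finset.card_eq_sum_ones, Nat.cast_sum, ← Finset.sum_add_distrib]
    refine Finset.sum_congr rfl fun e _ => ?_
    push_cast
    ring
  have hwE := hw E hU
  have hwF := hw F hF
  have hEd := Finset.sum_sdiff_sub_sum_sdiff (s₁ := E) (s₂ := F)
    (f := fun e : ℕ × ℕ => (1 : ℚ) - (ψ e.2 - ψ e.1))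
  have hneg : ∀ e ∈ E \ F, (1 : ℚ) - (ψ e.2 - ψ e.1) < 0 := by
    intro e he
    have := ((hmem e).1 (Finset.mem_sdiff.1 he).1).2.2
    linarith
  have hpos : ∀ e ∈ F \ E, 0 < (1 : ℚ) - (ψ e.2 - ψ e.1) := by
    intro e he
    rw [Finset.mem_sdiff, hmem] at he
    have h1 := hF.lt e he.1
    have h2 := hF.bound e he.1
    have h3 := h.1 e.1 e.2 h1 h2
    have h4 : ¬ 1 < ψ e.2 - ψ e.1 := fun hlt => he.2 ⟨hF.bounds e he.1, h1, hlt⟩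
    have h5 := lt_of_le_of_ne (not_lt.1 h4) h3
    linarith
  have key : ∑ e ∈ E, ((1 : ℚ) - (ψ e.2 - ψ e.1)) < ∑ e ∈ F, ((1 : ℚ) - (ψ e.2 - ψ e.1)) := by
    have h1 : ∑ e ∈ E \ F, ((1 : ℚ) - (ψ e.2 - ψ e.1)) ≤ 0 :=
      Finset.sum_nonpos fun e he => (hneg e he).le
    have h2 : 0 ≤ ∑ e ∈ F \ E, ((1 : ℚ) - (ψ e.2 - ψ e.1)) :=
      Finset.sum_nonneg fun e he => (hpos e he).le
    rcases (E \ F).eq_empty_or_nonempty with h3 | h3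
    · rcases (F \ E).eq_empty_or_nonempty with h4 | h4
      · exact absurd (Finset.Subset.antisymm (Finset.sdiff_eq_empty_iff_subset.1 h4)
          (Finset.sdiff_eq_empty_iff_subset.1 h3)) hne
      · have := Finset.sum_pos hpos h4
        linarith
    · have := Finset.sum_neg hneg h3
      linarith
  rw [hwE, hwF] at key
  have : (E.card : ℚ) < F.card := by linarith
  exact_mod_cast this

lemma exists_isPotential_add {m n : ℕ} {d d₁ d₂ : ℕ → ℤ} {ψ₁ ψ₂ : ℕ → ℚ}
    (h₁ : IsPotential m d₁ ψ₁) (h₂ : IsPotential n d₂ ψ₂) (hd₁ : ∀ i < m, d i = d₁ i)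
    (hd₂ : ∀ i < n, d (m + i) = d₂ i) : ∃ ψ, IsPotential (m + n) d ψ := by
  -- Lowering the second potential by a large `C` makes every difference across the two parts
  -- negative, so no pair across them is chosen.
  obtain ⟨C, hC⟩ : ∃ C : ℚ, ∀ i < m, ∀ j < n, ψ₂ j - ψ₁ i < C := by
    obtain ⟨C₁, hC₁⟩ := ((Finset.range m).image ψ₁).bddBelow
    obtain ⟨C₂, hC₂⟩ := ((Finset.range n).image ψ₂).bddAbove
    refine ⟨C₂ - C₁ + 1, fun i hi j hj => ?_⟩
    have h1 := hC₁ (Finset.mem_coe.2 (Finset.mem_image_of_mem _ (Finset.mem_range.2 hi)))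
    have h2 := hC₂ (Finset.mem_coe.2 (Finset.mem_image_of_mem _ (Finset.mem_range.2 hj)))
    linarith
  set ψ : ℕ → ℚ := fun i => if i < m then ψ₁ i else ψ₂ (i - m) - C with hψ
  have e1 : ∀ i < m, ψ i = ψ₁ i := fun i hi => if_pos hi
  have e2 : ∀ i, ψ (m + i) = ψ₂ i - C := fun i => by simp [hψ]
  have e3 : ∀ i < m, ∀ j < n, ¬ 1 < ψ (m + j) - ψ i := by
    intro i hi j hj
    have := hC i hi j hj
    rw [e1 i hi, e2]
    linarith
  refine ⟨ψ, fun i j hij hj => ?_, fun v hv => ?_⟩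
  · rcases Nat.lt_or_ge j m with hjm | hjm
    · rw [e1 j hjm, e1 i (hij.trans hjm)]
      exact h₁.1 i j hij hjm
    · obtain ⟨j, rfl⟩ := Nat.exists_eq_add_of_le hjm
      rcases Nat.lt_or_ge i m with him | him
      · have := hC i him j (by omega)
        rw [e1 i him, e2]
        intro h
        linarith
      · obtain ⟨i, rfl⟩ := Nat.exists_eq_add_of_le him
        rw [e2, e2, sub_sub_sub_cancel_right]
        exact h₂.1 i j (by omega) (by omega)
  · rw [Finset.sum_range_add]
    rcases Nat.lt_or_ge v m with hvm | hvm
    · rw [hd₁ v hvm, h₁.2 v hvm]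
      rw [Finset.sum_eq_zero (s := Finset.range n), add_zero]
      · refine Finset.sum_congr rfl fun x hx => ?_
        rw [e1 v hvm, e1 x (Finset.mem_range.1 hx)]
      · intro x hx
        rw [if_neg fun h => e3 v hvm x (Finset.mem_range.1 hx) h.2, if_neg (by omega), sub_zero]
    · obtain ⟨v, rfl⟩ := Nat.exists_eq_add_of_le hvm
      rw [hd₂ v (by omega), h₂.2 v (by omega)]
      rw [Finset.sum_eq_zero (s := Finset.range m), zero_add]
      · refine Finset.sum_congr rfl fun x hx => ?_
        simp only [e2, sub_sub_sub_cancel_right, Nat.add_lt_add_iff_left]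
      · intro x hx
        rw [Finset.mem_range] at hx
        rw [if_neg (by omega), if_neg fun h => e3 x hx v (by omega) h.2, sub_zero]

/-- The slope is chosen so that a difference exceeds `1` exactly when the distance exceeds `m - k -
1/2`. The half-integer threshold excludes equality, and the pairs at distance at least `m - k` have
the staircase as imbalance. -/
lemma isPotential_stair {k m : ℕ} (h : 2 * k < m) :
    IsPotential m (stair k m) fun r => 2 * r / (2 * ((m - k : ℕ) : ℚ) - 1) := by
  have hL : 1 ≤ m - k := by omega
  have hpos : (0 : ℚ) < 2 * ((m - k : ℕ) : ℚ) - 1 := by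
    have : (1 : ℚ) ≤ ((m - k : ℕ) : ℚ) := by exact_mod_cast hL
    linarith
  have hlt : ∀ i j : ℕ, 1 < 2 * (j : ℚ) / (2 * ((m - k : ℕ) : ℚ) - 1) -
      2 * (i : ℚ) / (2 * ((m - k : ℕ) : ℚ) - 1) ↔ i + (m - k) ≤ j := by
    intro i j
    rw [← sub_div, one_lt_div hpos]
    constructor
    · intro h
      have h' : 2 * (i : ℚ) + 2 * ((m - k : ℕ) : ℚ) < 2 * j + 1 := by linarith
      have h'' : 2 * i + 2 * (m - k) < 2 * j + 1 := by exact_mod_cast h'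
      omega
    · intro h
      have h' : (i : ℚ) + ((m - k : ℕ) : ℚ) ≤ j := by exact_mod_cast h
      linarith
  refine ⟨fun i j _ _ => ?_, fun v hv => ?_⟩
  · rw [← sub_div, Ne, div_eq_one_iff_eq hpos.ne']
    intro h
    have h' : 2 * (j : ℚ) + 1 = 2 * i + 2 * ((m - k : ℕ) : ℚ) := by linarith
    have h'' : 2 * j + 1 = 2 * i + 2 * (m - k) := by exact_mod_cast h'
    omega
  · simp only [hlt]
    rw [Finset.sum_sub_distrib, ← Finset.sum_filter, ← Finset.sum_filter]
    have f1 : (Finset.range m).filter (fun x => v < x ∧ v + (m - k) ≤ x) =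
        Finset.Ico (v + (m - k)) m := by
      ext x
      simp only [Finset.mem_filter, Finset.mem_range, Finset.mem_Ico]
      omega
    have f2 : (Finset.range m).filter (fun x => x < v ∧ x + (m - k) ≤ v) =
        Finset.range (v + k + 1 - m) := by
      ext x
      simp only [Finset.mem_filter, Finset.mem_range]
      omega
    rw [f1, f2]
    simp only [Finset.sum_const, Nat.card_Ico, Finset.card_range, nsmul_eq_mul, mul_one, stair]
    omega

namespace IsStairList

variable {l : List ℤ}

lemma exists_isPotential (h : IsStairList l) :
    ∃ ψ, IsPotential l.length (fun i => l.getD i 0) ψ := by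
  induction h with
  | nil => exact ⟨0, by simp [IsPotential]⟩
  | @append k m l hb hl ih =>
    obtain ⟨ψ, hψ⟩ := ih
    have := exists_isPotential_add (d := fun i => ((List.range m).map (stair k m) ++ l).getD i 0)
      (isPotential_stair hb.1) hψ ?_ ?_
    · simpa using this
    · intro i hi
      simp [List.getElem?_append_left, hi]
    · intro i hi
      simp [List.getElem?_append_right]

lemma getD_zero_nonneg (h : IsStairList l) : 0 ≤ l.getD 0 0 := by
  cases h with
  | nil => simp
  | @append k m l hb hl =>
    have := hb.1
    simp [show 0 < m by omega, stair]
    omega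

lemma getD_sub_one_le (h : IsStairList l) :
    ∀ i, i + 1 < l.length → l.getD i 0 - 1 ≤ l.getD (i + 1) 0 := by
  induction h with
  | nil => simp
  | @append k m l hb hl ih =>
    have hkm := hb.1
    have e1 : ∀ i < m, ((List.range m).map (stair k m) ++ l).getD i 0 = stair k m i := by
      intro i hi
      simp [List.getElem?_append_left, hi]
    have e2 : ∀ i, ((List.range m).map (stair k m) ++ l).getD (m + i) 0 = l.getD i 0 := by
      intro i
      simp [List.getElem?_append_right]
    intro i hi
    rcases lt_trichotomy (i + 1) m with hlt | heq | hgt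
    · rw [e1 _ hlt, e1 i (by omega)]
      unfold stair
      omega
    -- At a junction a block ends in `-k ≤ 0` and what follows starts nonnegative.
    · have e3 := e2 0
      rw [add_zero] at e3
      rw [e1 i (by omega), heq, e3]
      have := hl.getD_zero_nonneg
      unfold stair
      omega
    · obtain ⟨i, rfl⟩ := Nat.exists_eq_add_of_le (show m ≤ i by omega)
      rw [e2, add_assoc, e2]
      refine ih i ?_
      simp at hi
      omega

end IsStairList

/-! ### Score sequences as staircase lists -/

section Encoding

variable {n : ℕ}

/-- The sequence of the differences between `R` and the scores `0, 1, …, n - 1`. -/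
def excess (R : Fin n → ℤ) : List ℤ := List.ofFn fun i => R i - i

lemma excess_getD (R : Fin n → ℤ) (i : Fin n) : (excess R).getD i 0 = R i - i := by
  simp [excess]

lemma map_excess_getD (R : Fin n → ℤ) :
    (List.range n).map (fun i => (excess R).getD i 0) = excess R := by
  refine List.ext_getElem (by simp [excess]) fun i h1 h2 => ?_
  simp [List.getElem?_eq_getElem h2]

lemma sum_filter_eq (R : Fin n → ℤ) {k : ℕ} (hk : k ≤ n) :
    ∑ i ∈ Finset.univ.filter (fun i : Fin n => (i : ℕ) < k), R i =
      ∑ v ∈ Finset.range k, (excess R).getD v 0 + (k.choose 2 : ℤ) := by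
  have h1 : (k.choose 2 : ℤ) = ∑ v ∈ Finset.range k, (v : ℤ) := by
    rw [Nat.choose_two_right, ← Finset.sum_range_id, Nat.cast_sum]
  rw [h1, ← Finset.sum_add_distrib, Finset.sum_filter]
  have h2 : ∀ i : Fin n, (if (i : ℕ) < k then R i else 0) =
      (fun v : ℕ => if v < k then (excess R).getD v 0 + (v : ℤ) else 0) (i : ℕ) := by
    intro i
    simp only [excess_getD, sub_add_cancel]
  rw [Finset.sum_congr rfl fun i _ => h2 i, Fin.sum_univ_eq_sum_range
    (fun v : ℕ => if v < k then (excess R).getD v 0 + (v : ℤ) else 0), ← Finset.sum_filter]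
  refine Finset.sum_congr ?_ fun _ _ => rfl
  ext v
  simp only [Finset.mem_filter, Finset.mem_range]
  omega

/-- The feasible score sequences with a unique minimum tournament matrix. -/
lemma isFeasible_and_ncard_iff (R : Fin n → ℤ) :
    (IsFeasible R ∧ (UMin R).ncard = 1) ↔ IsStairList (excess R) := by
  rw [ncard_uMin_eq_one_iff (d := fun i => (excess R).getD i 0) (excess_getD R)]
  constructor
  · rintro ⟨⟨hmono, -, -⟩, E, hE⟩
    rw [← map_excess_getD R]
    refine hE.isStairList fun i j hij hj => ?_
    have h1 := excess_getD R ⟨i, hij.trans_lt hj⟩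
    have h2 := excess_getD R ⟨j, hj⟩
    have h3 := hmono (show (⟨i, hij.trans_lt hj⟩ : Fin n) ≤ ⟨j, hj⟩ from hij)
    simp only at h1 h2
    rw [h1, h2]
    linarith
  · intro h
    obtain ⟨ψ, hψ⟩ := h.exists_isPotential
    have hlen : (excess R).length = n := by simp [excess]
    rw [hlen] at hψ
    have hE := hψ.isUniqueMin
    refine ⟨⟨?_, ?_, ?_⟩, _, hE⟩
    · cases n with
      | zero => exact fun i => i.elim0
      | succ n =>
        refine Fin.monotone_iff_le_succ.2 fun i => ?_
        have h1 := h.getD_sub_one_le i (by rw [hlen]; omega)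
        have h2 := excess_getD R i.castSucc
        have h3 := excess_getD R i.succ
        simp only [Fin.val_castSucc, Fin.val_succ, Nat.cast_add, Nat.cast_one] at h2 h3
        linarith
    · have h1 := sum_filter_eq R le_rfl
      rw [hE.1.sum_range_eq_zero, zero_add, Finset.filter_true_of_mem fun i _ => i.2] at h1
      exact h1
    -- The Landau inequalities come for free: the partial sums of `d` count the edges of an upset
    -- set across a cut.
    · intro k _ hk
      have h1 := hE.1.sum_range_nonneg hk.le
      rw [sum_filter_eq R hk.le]
      linarith

end Encoding

/-! ### Counting staircase lists -/

/-- The staircase lists of length `n`. -/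
def stairLists (n : ℕ) : Set (List ℤ) := {l | IsStairList l ∧ l.length = n}

lemma numUnique_eq_ncard (n : ℕ) : numUnique n = (stairLists n).ncard := by
  have h1 : {R : Fin n → ℤ | IsFeasible R ∧ Set.ncard (UMin R) = 1} =
      excess ⁻¹' stairLists n := by
    ext R
    have hlen : (excess R).length = n := by simp [excess]
    exact (isFeasible_and_ncard_iff R).trans ⟨fun h => ⟨h, hlen⟩, fun h => h.1⟩
  have hinj : Function.Injective (excess (n := n)) := by
    intro R S h
    have := List.ofFn_injective h
    funext i
    have := congrFun this i
    simpa using this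
  rw [numUnique, h1, ← Set.ncard_image_of_injective _ hinj, Set.image_preimage_eq_of_subset]
  rintro l ⟨-, rfl⟩
  refine ⟨fun i => l.get i + i, ?_⟩
  simp [excess]

/-- A staircase block prepended to a list. -/
def prependBlock (p : ℕ × ℕ) (l : List ℤ) : List ℤ := (List.range p.2).map (stair p.1 p.2) ++ l

lemma prependBlock_injective (p : ℕ × ℕ) : Function.Injective (prependBlock p) :=
  fun _ _ h => List.append_cancel_left h

lemma prependBlock_getD {p : ℕ × ℕ} {l : List ℤ} {i : ℕ} (hi : i < p.2) :
    (prependBlock p l).getD i 0 = stair p.1 p.2 i := by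
  simp [prependBlock, List.getElem?_append_left, hi]

/-- The first entry is `k`, and for `k > 0` the first `-1` of the list, at position `m - k`, reveals
the length. For `k = 0` the length is `1` by the definition of a block. -/
lemma le_of_prependBlock_eq {p q : ℕ × ℕ} (hp : IsBlock p.1 p.2) (hq : IsBlock q.1 q.2)
    {l l' : List ℤ} (h : prependBlock p l = prependBlock q l') : p.1 = q.1 ∧ q.2 ≤ p.2 := by
  obtain ⟨k, m⟩ := p
  obtain ⟨k', m'⟩ := q
  obtain ⟨h1, h2⟩ := hp
  obtain ⟨h3, h4⟩ := hq
  simp only at *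
  have e0 := prependBlock_getD (p := (k, m)) (l := l) (i := 0) (by simp only; omega)
  rw [h, prependBlock_getD (by simp only; omega)] at e0
  have hk : k = k' := by
    unfold stair at e0
    simp only at e0
    omega
  refine ⟨hk, ?_⟩
  subst hk
  by_contra hlt
  have hk0 : k ≠ 0 := fun hk => by have := h2 hk; have := h4 hk; omega
  have e1 := prependBlock_getD (p := (k, m)) (l := l) (i := m - k) (by simp only; omega)
  rw [h, prependBlock_getD (by simp only; omega)] at e1
  unfold stair at e1
  simp only at e1
  omega

lemma eq_of_prependBlock_eq {p q : ℕ × ℕ} (hp : IsBlock p.1 p.2) (hq : IsBlock q.1 q.2)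
    {l l' : List ℤ} (h : prependBlock p l = prependBlock q l') : p = q := by
  have h1 := le_of_prependBlock_eq hp hq h
  have h2 := le_of_prependBlock_eq hq hp h.symm
  exact Prod.ext h1.1 (le_antisymm h2.2 h1.2)

instance (k m : ℕ) : Decidable (IsBlock k m) := inferInstanceAs (Decidable (_ ∧ _))

/-- The parameters of the blocks of length at most `n`. -/
def blocks (n : ℕ) : Finset (ℕ × ℕ) :=
  (Finset.range (n + 1) ×ˢ Finset.range (n + 1)).filter fun p => IsBlock p.1 p.2

lemma mem_blocks {n : ℕ} {p : ℕ × ℕ} : p ∈ blocks n ↔ IsBlock p.1 p.2 ∧ p.2 ≤ n := by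
  simp only [blocks, Finset.mem_filter, Finset.mem_product, Finset.mem_range]
  constructor
  · rintro ⟨h1, h2⟩
    exact ⟨h2, by omega⟩
  · rintro ⟨h1, h2⟩
    have := h1.1
    exact ⟨by omega, h1⟩

lemma stairLists_zero : stairLists 0 = {[]} := by
  ext l
  simp only [stairLists, Set.mem_ofPred_eq, List.length_eq_zero_iff, Set.mem_singleton_iff]
  exact ⟨fun h => h.2, fun h => ⟨h ▸ IsStairList.nil, h⟩⟩

lemma stairLists_eq_biUnion {n : ℕ} (hn : 1 ≤ n) :
    stairLists n = ⋃ p ∈ blocks n, prependBlock p '' stairLists (n - p.2) := by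
  ext l
  simp only [Set.mem_iUnion, Set.mem_image, exists_prop, mem_blocks]
  constructor
  · rintro ⟨h, hl⟩
    cases h with
    | nil => simp at hl; omega
    | @append k m l hb h =>
      simp only [List.length_append, List.length_map, List.length_range] at hl
      exact ⟨(k, m), ⟨hb, by simp only; omega⟩, l, ⟨h, by simp only; omega⟩, rfl⟩
  · rintro ⟨p, ⟨hb, hp⟩, l, ⟨h, hl⟩, rfl⟩
    refine ⟨IsStairList.append hb h, ?_⟩
    simp only [prependBlock, List.length_append, List.length_map, List.length_range]
    omega

lemma finite_stairLists (n : ℕ) : (stairLists n).Finite := by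
  induction n using Nat.strong_induction_on with
  | _ n ih =>
    rcases Nat.eq_zero_or_pos n with rfl | hn
    · rw [stairLists_zero]
      exact Set.finite_singleton _
    · rw [stairLists_eq_biUnion hn]
      refine Set.Finite.biUnion (Finset.finite_toSet _) fun p hp => (ih _ ?_).image _
      have := (mem_blocks.1 hp).1.1
      omega

lemma numUnique_eq_sum_blocks {n : ℕ} (hn : 1 ≤ n) :
    numUnique n = ∑ p ∈ blocks n, numUnique (n - p.2) := by
  classical
  simp only [numUnique_eq_ncard, Set.ncard_eq_toFinset_card _ (finite_stairLists _)]
  have h : (finite_stairLists n).toFinset = (blocks n).biUnion fun p =>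
      (finite_stairLists (n - p.2)).toFinset.image (prependBlock p) := by
    ext l
    rw [Set.Finite.mem_toFinset, stairLists_eq_biUnion hn]
    simp
  rw [h, Finset.card_biUnion]
  · exact Finset.sum_congr rfl fun p _ => Finset.card_image_of_injective _ (prependBlock_injective p)
  · intro p hp q hq hpq
    rw [Function.onFun, Finset.disjoint_left]
    intro l h1 h2
    rw [Finset.mem_image] at h1 h2
    obtain ⟨l1, -, rfl⟩ := h1
    obtain ⟨l2, -, h3⟩ := h2
    exact hpq (eq_of_prependBlock_eq (mem_blocks.1 hp).1 (mem_blocks.1 hq).1 h3.symm)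

/-- The number of staircase lists of length `n` which start with a nonzero entry. -/
noncomputable def numNonzero (n : ℕ) : ℕ :=
  ∑ k ∈ Finset.range n, ∑ j ∈ Finset.range (n - 2 * (k + 1)), numUnique j

/-- The first block is either the single `0` or has `k > 0`. -/
lemma numUnique_eq_add {n : ℕ} (hn : 1 ≤ n) :
    numUnique n = numUnique (n - 1) + numNonzero n := by
  rw [numUnique_eq_sum_blocks hn, blocks, Finset.sum_filter, Finset.sum_product,
    Finset.sum_range_succ', add_comm, numNonzero]
  congr 1
  · rw [Finset.sum_eq_single 1]
    · simp [IsBlock]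
    · intro m _ hm
      simp [IsBlock, hm]
    · simp
      omega
  · refine Finset.sum_congr rfl fun k _ => ?_
    -- The sum over block lengths `m` becomes one over the length `j = n - m` of the remainder.
    rw [← Finset.sum_range_reflect]
    simp only [Nat.add_sub_cancel, IsBlock]
    rw [← Finset.sum_filter]
    have : (Finset.range (n + 1)).filter
        (fun j => 2 * (k + 1) < n - j ∧ (k + 1 = 0 → n - j = 1)) =
        Finset.range (n - 2 * (k + 1)) := by
      ext j
      simp only [Finset.mem_filter, Finset.mem_range]
      omega
    rw [this]
    refine Finset.sum_congr rfl fun j hj => ?_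
    rw [Finset.mem_range] at hj
    congr 1
    omega

/-- A first block with `k ≥ 2` loses its two end entries and becomes a block for `k - 1`, two
shorter. The blocks with `k = 1` contribute the sum over all remainders `j < n`. -/
lemma numNonzero_add_two (n : ℕ) :
    numNonzero (n + 2) = ∑ j ∈ Finset.range n, numUnique j + numNonzero n := by
  unfold numNonzero
  rw [Finset.sum_range_succ', Finset.sum_range_succ, add_comm]
  congr 1
  rw [show n + 2 - 2 * (n + 1 + 1) = 0 by omega, Finset.sum_range_zero, add_zero]
  refine Finset.sum_congr rfl fun k _ => ?_
  rw [show n + 2 - 2 * (k + 1 + 1) = n - 2 * (k + 1) by omega]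

/-- Subtracting the relations of `numNonzero_add_two` for `n` and `n + 1` leaves the single term
`numUnique n` of the sums; the values of `numNonzero` are first differences of `numUnique`. -/
lemma numUnique_recurrence {n : ℕ} (hn : 1 ≤ n) :
    (numUnique (n + 3) : ℤ) - 2 * numUnique (n + 2) + numUnique n - numUnique (n - 1) = 0 := by
  have h0 := numUnique_eq_add hn
  have h1 := numUnique_eq_add (show 1 ≤ n + 1 by omega)
  have h2 := numUnique_eq_add (show 1 ≤ n + 2 by omega)
  have h3 := numUnique_eq_add (show 1 ≤ n + 3 by omega)
  have e1 := numNonzero_add_two n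
  have e2 := numNonzero_add_two (n + 1)
  rw [Finset.sum_range_succ] at e2
  simp only [Nat.add_sub_cancel, show n + 2 - 1 = n + 1 by omega, show n + 3 - 1 = n + 2 by omega,
    show n + 1 + 2 = n + 3 by omega] at *
  omega

lemma numUnique_initial : numUnique 0 = 1 ∧ numUnique 1 = 1 ∧ numUnique 2 = 1 ∧
    numUnique 3 = 2 ∧ numUnique 4 = 4 := by
  have h0 : numUnique 0 = 1 := by rw [numUnique_eq_ncard, stairLists_zero, Set.ncard_singleton]
  have z0 : numNonzero 0 = 0 := by simp [numNonzero]
  have z1 : numNonzero 1 = 0 := by simp [numNonzero]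
  have h1 := numUnique_eq_add (n := 1) le_rfl
  have h2 := numUnique_eq_add (n := 2) (by omega)
  have h3 := numUnique_eq_add (n := 3) (by omega)
  have h4 := numUnique_eq_add (n := 4) (by omega)
  have z2 := numNonzero_add_two 0
  have z3 := numNonzero_add_two 1
  have z4 := numNonzero_add_two 2
  simp only [Finset.sum_range_succ, Finset.sum_range_zero] at z2 z3 z4
  norm_num at *
  omega

/-! ### Roots of the characteristic polynomial and the closed form -/

lemma sqrtFive_sq : sqrtFive ^ 2 = 5 := by
  rw [sqrtFive, ← Complex.ofReal_pow, Real.sq_sqrt (by norm_num)]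
  norm_num

lemma sqrtPlus_sq : sqrtPlus ^ 2 = 2 * sqrtFive + 3 := by
  rw [sqrtPlus, ← Complex.ofReal_pow, Real.sq_sqrt (by positivity), sqrtFive]
  push_cast
  rfl

lemma three_lt : (3 : ℝ) < 2 * Real.sqrt 5 := by
  have : (2 : ℝ) < Real.sqrt 5 := Real.lt_sqrt_of_sq_lt (by norm_num)
  linarith

lemma sqrtMinus_sq : sqrtMinus ^ 2 = 2 * sqrtFive - 3 := by
  rw [sqrtMinus, ← Complex.ofReal_pow, Real.sq_sqrt (by linarith [three_lt]), sqrtFive]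
  push_cast
  rfl

lemma sqrtFive_ne_zero : sqrtFive ≠ 0 := by
  intro h
  have := sqrtFive_sq
  rw [h] at this
  norm_num at this

lemma sqrtPlus_ne_zero : sqrtPlus ≠ 0 := by
  rw [sqrtPlus, Complex.ofReal_ne_zero]
  exact (Real.sqrt_pos.2 (by positivity)).ne'

lemma sqrtMinus_ne_zero : sqrtMinus ≠ 0 := by
  rw [sqrtMinus, Complex.ofReal_ne_zero]
  exact (Real.sqrt_pos.2 (by linarith [three_lt])).ne'

lemma I_mul_sqrtMinus_sq : (Complex.I * sqrtMinus) ^ 2 = 3 - 2 * sqrtFive := by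
  rw [mul_pow, Complex.I_sq, sqrtMinus_sq]
  ring

lemma quartic_factor (x : ℂ) : x ^ 4 - 2 * x ^ 3 + x - 1 =
    (x - (1 - sqrtPlus) / 2) * ((x - (1 + sqrtPlus) / 2) *
      ((x - (1 - Complex.I * sqrtMinus) / 2) * (x - (1 + Complex.I * sqrtMinus) / 2))) := by
  have h1 : (x - (1 - sqrtPlus) / 2) * (x - (1 + sqrtPlus) / 2) =
      x ^ 2 - x - (1 + sqrtFive) / 2 := by
    linear_combination (-1 / 4) * sqrtPlus_sq
  have h2 : (x - (1 - Complex.I * sqrtMinus) / 2) * (x - (1 + Complex.I * sqrtMinus) / 2) =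
      x ^ 2 - x - (1 - sqrtFive) / 2 := by
    linear_combination (-1 / 4) * I_mul_sqrtMinus_sq
  rw [h2, ← mul_assoc, h1]
  linear_combination (1 / 4) * sqrtFive_sq

open Polynomial in
lemma roots_quartic : (X ^ 4 - 2 * X ^ 3 + X - 1 : ℂ[X]).roots =
      {(1 - sqrtPlus) / 2, (1 + sqrtPlus) / 2,
        (1 - Complex.I * sqrtMinus) / 2, (1 + Complex.I * sqrtMinus) / 2} := by
  rw [← roots_multiset_prod_X_sub_C ({(1 - sqrtPlus) / 2, (1 + sqrtPlus) / 2,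
        (1 - Complex.I * sqrtMinus) / 2, (1 + Complex.I * sqrtMinus) / 2} : Multiset ℂ)]
  congr 1
  refine Polynomial.funext fun x => ?_
  simp only [Multiset.insert_eq_cons, Multiset.map_cons, Multiset.map_singleton,
    Multiset.prod_cons, Multiset.prod_singleton, eval_mul, eval_sub, eval_add, eval_pow, eval_X,
    eval_C, eval_one, eval_ofNat]
  exact quartic_factor x

/-- The closed formula for `numUnique (m + 1)`. -/
noncomputable def closedForm (m : ℕ) : ℂ :=
  (sqrtFive + 1) / 4 * (1 / sqrtFive - 1 / sqrtPlus) * ((1 - sqrtPlus) / 2) ^ m +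
    (sqrtFive + 1) / 4 * (1 / sqrtFive + 1 / sqrtPlus) * ((1 + sqrtPlus) / 2) ^ m +
    (sqrtFive - 1) / 4 * (1 / sqrtFive - Complex.I / sqrtMinus) *
      ((1 - Complex.I * sqrtMinus) / 2) ^ m +
    (sqrtFive - 1) / 4 * (1 / sqrtFive + Complex.I / sqrtMinus) *
      ((1 + Complex.I * sqrtMinus) / 2) ^ m

lemma closedForm_recurrence (m : ℕ) :
    closedForm (m + 4) = 2 * closedForm (m + 3) - closedForm (m + 1) + closedForm m := by
  have key : ∀ r : ℂ, r ^ 4 - 2 * r ^ 3 + r - 1 = 0 →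
      r ^ (m + 4) = 2 * r ^ (m + 3) - r ^ (m + 1) + r ^ m := by
    intro r hr
    linear_combination r ^ m * hr
  unfold closedForm
  rw [key _ (by rw [quartic_factor]; ring), key ((1 + sqrtPlus) / 2) (by rw [quartic_factor]; ring),
    key ((1 - Complex.I * sqrtMinus) / 2) (by rw [quartic_factor]; ring),
    key ((1 + Complex.I * sqrtMinus) / 2) (by rw [quartic_factor]; ring)]
  ring

/-- Written with `s = sqrtPlus` and `s = Complex.I * sqrtMinus`, both conjugate pairs take the same
shape up to sign. Each bracket is even in `s`, so its values need only `s ^ 2`, which lies in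
`ℚ(√5)`. -/
lemma closedForm_eq (m : ℕ) : closedForm m =
    (sqrtFive + 1) / 4 * (sqrtFive / 5 * (((1 + sqrtPlus) / 2) ^ m + ((1 - sqrtPlus) / 2) ^ m) +
      (((1 + sqrtPlus) / 2) ^ m - ((1 - sqrtPlus) / 2) ^ m) / sqrtPlus) +
    (sqrtFive - 1) / 4 * (sqrtFive / 5 * (((1 + Complex.I * sqrtMinus) / 2) ^ m +
        ((1 - Complex.I * sqrtMinus) / 2) ^ m) -
      (((1 + Complex.I * sqrtMinus) / 2) ^ m - ((1 - Complex.I * sqrtMinus) / 2) ^ m) /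
        (Complex.I * sqrtMinus)) := by
  have h1 : 1 / sqrtFive = sqrtFive / 5 := by
    rw [div_eq_div_iff sqrtFive_ne_zero (by norm_num)]
    linear_combination -sqrtFive_sq
  have h2 : Complex.I / sqrtMinus = -(1 / (Complex.I * sqrtMinus)) := by
    rw [one_div, mul_inv, Complex.inv_I]
    ring
  rw [closedForm, h1, h2]
  ring

lemma closedForm_initial :
    closedForm 0 = 1 ∧ closedForm 1 = 1 ∧ closedForm 2 = 2 ∧ closedForm 3 = 4 := by
  have d0 : ∀ s : ℂ, (((1 + s) / 2) ^ 0 - ((1 - s) / 2) ^ 0) / s = 0 := by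
    intro s
    simp
  have d1 : ∀ s : ℂ, s ≠ 0 → (((1 + s) / 2) ^ 1 - ((1 - s) / 2) ^ 1) / s = 1 := by
    intro s hs
    rw [div_eq_iff hs]
    ring
  have d2 : ∀ s : ℂ, s ≠ 0 → (((1 + s) / 2) ^ 2 - ((1 - s) / 2) ^ 2) / s = 1 := by
    intro s hs
    rw [div_eq_iff hs]
    ring
  have d3 : ∀ s : ℂ, s ≠ 0 → (((1 + s) / 2) ^ 3 - ((1 - s) / 2) ^ 3) / s = (3 + s ^ 2) / 4 := by
    intro s hs
    rw [div_eq_iff hs]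
    ring
  have s2 : ∀ s : ℂ, ((1 + s) / 2) ^ 2 + ((1 - s) / 2) ^ 2 = (1 + s ^ 2) / 2 := by
    intro s
    ring
  have s3 : ∀ s : ℂ, ((1 + s) / 2) ^ 3 + ((1 - s) / 2) ^ 3 = (1 + 3 * s ^ 2) / 4 := by
    intro s
    ring
  have hp := sqrtPlus_ne_zero
  have hm : Complex.I * sqrtMinus ≠ 0 := mul_ne_zero Complex.I_ne_zero sqrtMinus_ne_zero
  have h5 := sqrtFive_sq
  refine ⟨?_, ?_, ?_, ?_⟩
  · rw [closedForm_eq, d0, d0]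
    linear_combination (1 / 5) * h5
  · rw [closedForm_eq, d1 _ hp, d1 _ hm]
    linear_combination (1 / 10) * h5
  · rw [closedForm_eq, d2 _ hp, d2 _ hm, s2, s2, sqrtPlus_sq, I_mul_sqrtMinus_sq]
    linear_combination (3 / 10) * h5
  · rw [closedForm_eq, d3 _ hp, d3 _ hm, s3, s3, sqrtPlus_sq, I_mul_sqrtMinus_sq]
    linear_combination (13 / 20) * h5

lemma numUnique_succ_eq_closedForm (m : ℕ) : (numUnique (m + 1) : ℂ) = closedForm m := by
  -- The recurrence has order four, so the induction carries four consecutive values.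
  suffices h : (numUnique (m + 1) : ℂ) = closedForm m ∧
      (numUnique (m + 2) : ℂ) = closedForm (m + 1) ∧
      (numUnique (m + 3) : ℂ) = closedForm (m + 2) ∧
      (numUnique (m + 4) : ℂ) = closedForm (m + 3) from h.1
  induction m with
  | zero =>
    obtain ⟨-, a1, a2, a3, a4⟩ := numUnique_initial
    obtain ⟨c0, c1, c2, c3⟩ := closedForm_initial
    simp [a1, a2, a3, a4, c0, c1, c2, c3]
  | succ m ih =>
    obtain ⟨i0, i1, i2, i3⟩ := ih
    refine ⟨i1, i2, i3, ?_⟩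
    have h : ((numUnique (m + 5) : ℤ) : ℂ) - 2 * (numUnique (m + 4) : ℤ) +
        (numUnique (m + 2) : ℤ) - (numUnique (m + 1) : ℤ) = 0 := by
      exact_mod_cast numUnique_recurrence (n := m + 2) (by omega)
    push_cast at h
    rw [show m + 1 + 4 = m + 5 by omega, show m + 1 + 3 = m + 4 by omega, closedForm_recurrence]
    rw [i0, i1, i3] at h
    linear_combination h

end Tournament

open Polynomial Tournament in
theorem theorem1p5 :
    -- the linear recurrence, with its initial values
    (∀ n : ℕ, 1 ≤ n →
      (numUnique (n + 3) : ℤ) - 2 * numUnique (n + 2) + numUnique n - numUnique (n - 1) = 0) ∧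
    (numUnique 0 = 1 ∧ numUnique 1 = 1 ∧ numUnique 2 = 1 ∧ numUnique 3 = 2 ∧ numUnique 4 = 4) ∧
    -- the roots of the characteristic polynomial, with multiplicity
    (X ^ 4 - 2 * X ^ 3 + X - 1 : ℂ[X]).roots =
      {(1 - sqrtPlus) / 2, (1 + sqrtPlus) / 2,
        (1 - Complex.I * sqrtMinus) / 2, (1 + Complex.I * sqrtMinus) / 2} ∧
    -- the closed formula
    (∀ n : ℕ, 1 ≤ n →
      (numUnique n : ℂ) =
        (sqrtFive + 1) / 4 * (1 / sqrtFive - 1 / sqrtPlus) *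
            ((1 - sqrtPlus) / 2) ^ (n - 1) +
          (sqrtFive + 1) / 4 * (1 / sqrtFive + 1 / sqrtPlus) *
            ((1 + sqrtPlus) / 2) ^ (n - 1) +
          (sqrtFive - 1) / 4 * (1 / sqrtFive - Complex.I / sqrtMinus) *
            ((1 - Complex.I * sqrtMinus) / 2) ^ (n - 1) +
          (sqrtFive - 1) / 4 * (1 / sqrtFive + Complex.I / sqrtMinus) *
            ((1 + Complex.I * sqrtMinus) / 2) ^ (n - 1)) := by
  refine ⟨fun n hn => numUnique_recurrence hn, numUnique_initial, roots_quartic, fun n hn => ?_⟩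
  obtain ⟨m, rfl⟩ := Nat.exists_eq_add_of_le' hn
  exact numUnique_succ_eq_closedForm m
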